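/- Let $\psi:[0,\infty)\to[0,\infty)$ be an increasing concave function with $\psi(0)=0$ and $\lim_{t\to\infty}\psi(t)=\infty$ (we write $\psi\in\Omega$; this includes in particular all $\psi\in\Omega_b$, that is, those $\psi\in\Omega$ with $\psi(t)=O(t)$ as $t\to0$). Let $\mathcal M_\psi=\mathcal M_\psi(\mathbb R_+)$ be the Lorentz space of (classes of) measurable functions $f$ on $(0,\infty)$ with $$\|f\|_{\mathcal M_\psi}=\sup_{t>0}\frac1{\psi(t)}\int_0^t\mu(f,s)\,ds<\infty,$$ where $\mu(f,s)=\inf\{r>0:\ |\{x:|f(x)|>r\}|\le s\}$ is the decreasing rearrangement. For $a>0$ put $D_af(t)=f(at)$. The lower and upper Boyd indices of $\mathcal M_\psi$ are $$\mathfrak p_{\mathcal M_\psi}=\lim_{a\downarrow0}\frac{\log a^{-1}}{\log\|D_a\|_{\mathcal M_\psi\to\mathcal M_\psi}},\qquad \mathfrak q_{\mathcal M_\psi}=\lim_{a\to\infty}\frac{\log a^{-1}}{\log\|D_a\|_{\mathcal M_\psi\to\mathcal M_\psi}},$$ with values in $[1,\infty]$, a quotient with zero denominator being $\infty$. A state on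 $L^\infty(0,\infty)$ is a positive continuous linear functional $\omega$ with $\omega(1)=1$. It is dilation invariant if $\omega(D_af)=\omega(f)$ for all $f\in L^\infty(0,\infty)$ and all $a>0$ (nothing is assumed about where $\omega$ is supported), and $\psi$-compatible if there exists $a>1$ with $$\omega\big(\big[t\mapsto\psi(at)/\psi(t)\big]\big)=1.$$ Then: (i) there exists a dilation invariant and $\psi$-compatible state if and only if $\mathfrak p_{\mathcal M_\psi}=1$; (ii) every dilation invariant state is $\psi$-compatible if and only if $\mathfrak p_{\mathcal M_\psi}=\mathfrak q_{\mathcal M_\psi}=1$. -/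

import Mathlib

open MeasureTheory Set Filter Topology
open scoped ENNReal ComplexOrder

/-- The class `Ω` of increasing concave functions `ψ : [0, ∞) → [0, ∞)` with `ψ 0 = 0` and
`ψ t → ∞` as `t → ∞`; only the values of `ψ` on `[0, ∞)` matter. -/
structure IsOmega (ψ : ℝ → ℝ) : Prop where
  concaveOn : ConcaveOn ℝ (Ici 0) ψ
  monotoneOn : MonotoneOn ψ (Ici 0)
  map_zero : ψ 0 = 0
  tendsto_atTop : Tendsto ψ atTop atTop

/-- Lebesgue measure on the half-line `(0, ∞)`. -/
noncomputable def halfLine : Measure ℝ := volume.restrict (Ioi 0)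

/-- The complex space `L^∞(0, ∞)`. -/
abbrev LInftyHalfLine : Type := Lp ℂ ∞ halfLine

theorem quasiMeasurePreserving_dilate {a : ℝ} (ha : 0 < a) :
    Measure.QuasiMeasurePreserving (fun t : ℝ => a * t) halfLine halfLine := by
  have h : Measure.QuasiMeasurePreserving (fun t : ℝ => a * t) volume volume := by
    refine ⟨measurable_const_mul a, ?_⟩
    rw [Real.map_volume_mul_left ha.ne']
    exact Measure.smul_absolutelyContinuous
  exact h.restrict fun t ht => mul_pos ha ht

theorem memLp_dilate {a : ℝ} (ha : 0 < a) {f : ℝ → ℂ} (hf : MemLp f ∞ halfLine) :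
    MemLp (fun t => f (a * t)) ∞ halfLine := by
  have hq := quasiMeasurePreserving_dilate ha
  refine memLp_top_of_bound (C := (eLpNormEssSup f halfLine).toReal)
    (hf.1.comp_quasiMeasurePreserving hq) ?_
  have hlt : eLpNormEssSup f halfLine < ∞ := by
    simpa [eLpNorm_exponent_top] using hf.2
  have hb : ∀ᵐ t ∂halfLine, ‖f t‖ ≤ (eLpNormEssSup f halfLine).toReal := by
    filter_upwards [enorm_ae_le_eLpNormEssSup f halfLine] with t ht
    simpa using ENNReal.toReal_mono hlt.ne ht
  exact hq.ae hb

/-- The dilation operator on `L^∞(0, ∞)`, `D_a f (t) = f (a t)` for `a > 0`. -/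
noncomputable def dilateLp {a : ℝ} (ha : 0 < a) (f : LInftyHalfLine) : LInftyHalfLine :=
  (memLp_dilate ha (Lp.memLp f)).toLp

theorem memLp_one_halfLine : MemLp (fun _ : ℝ => (1 : ℂ)) ∞ halfLine :=
  memLp_top_const 1

/-- A state of `L^∞(0, ∞)`: a continuous linear functional which is positive and takes the
value `1` at the unit. -/
structure IsState (ω : LInftyHalfLine →L[ℂ] ℂ) : Prop where
  nonneg : ∀ f : LInftyHalfLine, (∀ᵐ t ∂halfLine, 0 ≤ f t) → 0 ≤ ω f
  map_one : ω memLp_one_halfLine.toLp = 1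

/-- Dilation invariance: `ω (D_a f) = ω f` for all `f` and all `a > 0`. -/
def IsDilationInvariant (ω : LInftyHalfLine →L[ℂ] ℂ) : Prop :=
  ∀ (a : ℝ) (ha : 0 < a) (f : LInftyHalfLine), ω (dilateLp ha f) = ω f

theorem IsOmega.nonneg {ψ : ℝ → ℝ} (hψ : IsOmega ψ) {t : ℝ} (ht : 0 ≤ t) : 0 ≤ ψ t := by
  rw [← hψ.map_zero]
  exact hψ.monotoneOn (mem_Ici.2 le_rfl) ht ht

theorem IsOmega.map_mul_le {ψ : ℝ → ℝ} (hψ : IsOmega ψ) {a t : ℝ} (ha : 1 < a) (ht : 0 ≤ t) :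
    ψ (a * t) ≤ a * ψ t := by
  have ha0 : 0 < a := by linarith
  have hat : a * t ∈ Ici (0 : ℝ) := mem_Ici.2 (by positivity)
  have h := hψ.concaveOn.2 hat (mem_Ici.2 (le_refl (0 : ℝ)))
    (inv_nonneg.2 ha0.le) (sub_nonneg.2 (inv_le_one_of_one_le₀ ha.le))
    (add_sub_cancel a⁻¹ 1)
  have e : a⁻¹ * (a * t) = t := by field_simp
  simp only [smul_eq_mul, mul_zero, add_zero, hψ.map_zero, e] at h
  rwa [inv_mul_le_iff₀ ha0] at h

theorem IsOmega.memLp_ratio {ψ : ℝ → ℝ} (hψ : IsOmega ψ) {a : ℝ} (ha : 1 < a) :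
    MemLp (fun t => ((ψ (a * t) / ψ t : ℝ) : ℂ)) ∞ halfLine := by
  have ha0 : 0 < a := by linarith
  have h1 : AEMeasurable ψ halfLine :=
    aemeasurable_restrict_of_monotoneOn measurableSet_Ioi
      (hψ.monotoneOn.mono Ioi_subset_Ici_self)
  have h2 : AEMeasurable (fun t => ψ (a * t)) halfLine :=
    h1.comp_quasiMeasurePreserving (quasiMeasurePreserving_dilate ha0)
  refine memLp_top_of_bound (C := a)
    (Complex.measurable_ofReal.comp_aemeasurable (h2.div h1)).aestronglyMeasurable ?_
  refine (ae_restrict_iff' measurableSet_Ioi).2 (Eventually.of_forall fun t ht => ?_)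
  have ht0 : (0 : ℝ) ≤ t := le_of_lt ht
  rw [Complex.norm_real, Real.norm_of_nonneg
    (div_nonneg (hψ.nonneg (by positivity)) (hψ.nonneg ht0))]
  exact div_le_of_le_mul₀ (hψ.nonneg ht0) ha0.le (hψ.map_mul_le ha ht0)

/-- `ψ`-compatibility of a functional `ω`: there is `a > 1` such that `ω` takes the value `1` at
the (bounded) function `t ↦ ψ (a t) / ψ t`. -/
def IsCompatible {ψ : ℝ → ℝ} (hψ : IsOmega ψ) (ω : LInftyHalfLine →L[ℂ] ℂ) : Prop :=
  ∃ (a : ℝ) (ha : 1 < a), ω (hψ.memLp_ratio ha).toLp = 1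

/-- The distribution function `n(f, r) = |{t > 0 : |f t| > r}|`. -/
noncomputable def distribution (f : ℝ → ℂ) (r : ℝ≥0∞) : ℝ≥0∞ :=
  halfLine {t | r < ‖f t‖ₑ}

/-- The decreasing rearrangement `μ(f, s) = inf {r : n(f, r) ≤ s}`, that is, the generalized
`s`-number function of `f` for the trace on `L^∞(0, ∞)` given by Lebesgue integration. -/
noncomputable def rearrangement (f : ℝ → ℂ) (s : ℝ) : ℝ≥0∞ :=
  sInf {r : ℝ≥0∞ | distribution f r ≤ ENNReal.ofReal s}

/-- The Lorentz norm `sup_{t > 0} ψ(t)⁻¹ ∫_0^t μ(f, s) ds`. The Lorentz space `ℳ_ψ(0, ∞)`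
consists of the classes of measurable functions for which it is finite. -/
noncomputable def lorentzNorm (ψ : ℝ → ℝ) (f : ℝ → ℂ) : ℝ≥0∞ :=
  ⨆ (t : ℝ) (_ : 0 < t), (∫⁻ s in Ioc 0 t, rearrangement f s) / ENNReal.ofReal (ψ t)

/-- The operator norm `‖D_a‖_{E → E}` of the dilation `D_a f (t) = f (a t)`, for the Banach space
`E` of (classes of) measurable functions on the half-line with norm `ρ`: the supremum of
`ρ (D_a f)` over the unit ball of `E`. -/
noncomputable def dilationNorm (ρ : (ℝ → ℂ) → ℝ≥0∞) (a : ℝ) : ℝ≥0∞ :=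
  ⨆ (f : ℝ → ℂ) (_ : AEStronglyMeasurable f halfLine) (_ : ρ f ≤ 1), ρ fun t => f (a * t)

/-- `p` is the lower Boyd index of the space with norm `ρ`:
`p = lim_{a ↓ 0} log a⁻¹ / log ‖D_a‖`. The quotient is taken in `[0, ∞]`, where a positive number
divided by `0` is `∞`; for `0 < a < 1`, `log a⁻¹ > 0` and, in a symmetric space,
`log ‖D_a‖ ≥ 0`. -/
def HasLowerBoydIndex (ρ : (ℝ → ℂ) → ℝ≥0∞) (p : ℝ≥0∞) : Prop :=
  Tendsto (fun a : ℝ => ENNReal.ofReal (Real.log a⁻¹) /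
    ENNReal.ofReal (Real.log (dilationNorm ρ a).toReal)) (𝓝[>] 0) (𝓝 p)

/-- `q` is the upper Boyd index of the space with norm `ρ`:
`q = lim_{a → ∞} log a⁻¹ / log ‖D_a‖`. For `a > 1`, `log a⁻¹ < 0` and, in a symmetric space,
`log ‖D_a‖ ≤ 0`; both signs are changed so that the quotient can be taken in `[0, ∞]`, where a
positive number divided by `0` is `∞`. -/
def HasUpperBoydIndex (ρ : (ℝ → ℂ) → ℝ≥0∞) (q : ℝ≥0∞) : Prop :=
  Tendsto (fun a : ℝ => ENNReal.ofReal (-Real.log a⁻¹) /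
    ENNReal.ofReal (-Real.log (dilationNorm ρ a).toReal)) atTop (𝓝 q)

/-! Put M(a) = sup_{t>0} ψ(at)/ψ(t) (`dilationSup`). Testing on multiples of indicators of (0, b]
gives ‖D_a‖ = M(a)/a (`dilationNorm_eq`). Since M is submultiplicative, the lower index is 1 iff M =
1 on (0, 1); the upper index is 1 iff log M(a) = o(log a) as a → ∞.

For a > 1 the ratio ψ(at)/ψ(t) lies in [1, a], so a state maps it to 1 iff it kills the cocycle
log(ψ(at)/ψ(t)) (`map_ratio_eq_one_iff`). Under a dilation invariant state the value of the cocycle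
is additive in log a, so large dilations control a fixed one. This yields the lower index from one
compatible state, and compatibility of every invariant state from the upper index.

The converse directions need invariant states, obtained as ultrafilter limits of logarithmic means
over (t, Rt] with R → ∞ (`exists_tendsto_logMean`). The base points t are free: placing the
intervals where ψ is nearly constant gives a compatible state, and placing them where ψ grows like a
power of R gives an incompatible one (`le_integral_logRatio`). -/

/-! ### Dilation norms on the Lorentz space. -/

theorem IsOmega.pos {ψ : ℝ → ℝ} (hψ : IsOmega ψ) {t : ℝ} (ht : 0 < t) : 0 < ψ t := by
  refine lt_of_le_of_ne (hψ.nonneg ht.le) fun h0 => ?_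
  obtain ⟨s, hs1, hs2⟩ :=
    ((hψ.tendsto_atTop.eventually_gt_atTop 0).and (eventually_gt_atTop t)).exists
  have h := hψ.map_mul_le (a := s / t) (by rwa [one_lt_div ht]) ht.le
  rw [div_mul_cancel₀ _ ht.ne', ← h0, mul_zero] at h
  linarith

theorem distribution_dilate {a : ℝ} (ha : 0 < a) (f : ℝ → ℂ) (r : ℝ≥0∞) :
    distribution (fun t => f (a * t)) r = ENNReal.ofReal a⁻¹ * distribution f r := by
  unfold distribution halfLine
  rw [Measure.restrict_apply' measurableSet_Ioi, Measure.restrict_apply' measurableSet_Ioi]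
  have h := Real.volume_preimage_mul_left ha.ne' ({t | r < ‖f t‖ₑ} ∩ Ioi 0)
  rw [abs_of_pos (inv_pos.2 ha)] at h
  rw [← h]
  congr 1
  ext t
  simp [ha]

theorem rearrangement_dilate {a : ℝ} (ha : 0 < a) (f : ℝ → ℂ) (s : ℝ) :
    rearrangement (fun t => f (a * t)) s = rearrangement f (a * s) := by
  unfold rearrangement
  congr 1
  ext r
  have h0 : ENNReal.ofReal a ≠ 0 := by simpa using ha
  rw [mem_ofPred_eq, mem_ofPred_eq, distribution_dilate ha, ENNReal.ofReal_mul ha.le,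
    ENNReal.ofReal_inv_of_pos ha, ENNReal.inv_mul_le_iff h0 ENNReal.ofReal_ne_top]

theorem setLIntegral_Ioc_comp_mul_left {a : ℝ} (ha : 0 < a) (g : ℝ → ℝ≥0∞) (t : ℝ) :
    ∫⁻ s in Ioc 0 t, g (a * s) = ENNReal.ofReal a⁻¹ * ∫⁻ s in Ioc 0 (a * t), g s := by
  -- Changing variables along a measurable embedding requires no measurability of `g`.
  have he : MeasurableEmbedding (fun s : ℝ => a * s) :=
    (Homeomorph.mulLeft₀ a ha.ne').measurableEmbedding
  have hp : (fun s : ℝ => a * s) ⁻¹' Ioc 0 (a * t) = Ioc 0 t := by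
    ext s
    rw [mem_preimage, mem_Ioc, mem_Ioc, mul_pos_iff_of_pos_left ha, mul_le_mul_iff_right₀ ha]
  have h := he.lintegral_map (μ := volume.restrict (Ioc 0 t)) g
  rw [← h, ← hp, ← he.restrict_map, Real.map_volume_mul_left ha.ne',
    abs_of_pos (inv_pos.2 ha), Measure.restrict_smul, lintegral_smul_measure, smul_eq_mul]

theorem lorentzNorm_dilate {a : ℝ} (ha : 0 < a) (ψ : ℝ → ℝ) (f : ℝ → ℂ) :
    lorentzNorm ψ (fun t => f (a * t)) = ⨆ (t : ℝ) (_ : 0 < t),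
      (ENNReal.ofReal a⁻¹ * ∫⁻ s in Ioc 0 (a * t), rearrangement f s) / ENNReal.ofReal (ψ t) := by
  unfold lorentzNorm
  simp_rw [rearrangement_dilate ha, setLIntegral_Ioc_comp_mul_left ha]

theorem IsOmega.lorentzNorm_dilate_le {ψ : ℝ → ℝ} (hψ : IsOmega ψ) {a m : ℝ} (ha : 0 < a)
    (hm : ∀ t, 0 < t → ψ (a * t) / ψ t ≤ m) {f : ℝ → ℂ} (hf : lorentzNorm ψ f ≤ 1) :
    lorentzNorm ψ (fun t => f (a * t)) ≤ ENNReal.ofReal (m / a) := by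
  rw [lorentzNorm_dilate ha]
  refine iSup₂_le fun t ht => ?_
  have hat : 0 < a * t := mul_pos ha ht
  have h1 : (∫⁻ s in Ioc 0 (a * t), rearrangement f s) / ENNReal.ofReal (ψ (a * t)) ≤ 1 :=
    (le_iSup₂ (f := fun (t : ℝ) (_ : 0 < t) =>
      (∫⁻ s in Ioc 0 t, rearrangement f s) / ENNReal.ofReal (ψ t)) (a * t) hat).trans hf
  rw [ENNReal.div_le_iff (by simpa using hψ.pos hat) ENNReal.ofReal_ne_top, one_mul] at h1
  rw [ENNReal.div_le_iff (by simpa using hψ.pos ht) ENNReal.ofReal_ne_top]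
  refine (mul_le_mul_right h1 _).trans ?_
  rw [← ENNReal.ofReal_mul (inv_nonneg.2 ha.le), ← ENNReal.ofReal_mul' (hψ.nonneg ht.le)]
  refine ENNReal.ofReal_le_ofReal ?_
  have h2 := (div_le_iff₀ (hψ.pos ht)).1 (hm t ht)
  calc a⁻¹ * ψ (a * t) ≤ a⁻¹ * (m * ψ t) := by gcongr
    _ = m / a * ψ t := by ring

/-- The interval is open at `b` because at s = b the level r = 0 is already admissible. For s < b <
0 the truncation in `ENNReal.ofReal` would break the formula, hence `hs`. -/
theorem rearrangement_indicator {c b s : ℝ} (hs : 0 ≤ s) :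
    rearrangement ((Ioc 0 b).indicator fun _ => (c : ℂ)) s =
      (Iio b).indicator (fun _ => ‖(c : ℂ)‖ₑ) s := by
  have hd : ∀ r : ℝ≥0∞, distribution ((Ioc 0 b).indicator fun _ => (c : ℂ)) r =
      if r < ‖(c : ℂ)‖ₑ then ENNReal.ofReal b else 0 := by
    intro r
    unfold distribution halfLine
    rw [Measure.restrict_apply' measurableSet_Ioi]
    split_ifs with h
    · have : {t | r < ‖(Ioc 0 b).indicator (fun _ => (c : ℂ)) t‖ₑ} ∩ Ioi 0 = Ioc 0 b := by
        ext t
        by_cases ht : t ∈ Ioc 0 b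
        · simpa [ht, h] using ht.1
        · simp [ht]
      rw [this, Real.volume_Ioc, sub_zero]
    · have : {t | r < ‖(Ioc 0 b).indicator (fun _ => (c : ℂ)) t‖ₑ} ∩ Ioi 0 = ∅ := by
        ext t
        by_cases ht : t ∈ Ioc 0 b <;> simp [ht]
        intro h'
        exact absurd h' (by simpa using h)
      rw [this, measure_empty]
  unfold rearrangement
  simp_rw [hd]
  by_cases hsb : s < b
  · rw [indicator_of_mem (mem_Iio.2 hsb)]
    have : {r : ℝ≥0∞ | (if r < ‖(c : ℂ)‖ₑ then ENNReal.ofReal b else 0) ≤ ENNReal.ofReal s} =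
        Ici ‖(c : ℂ)‖ₑ := by
      ext r
      rw [mem_ofPred_eq, mem_Ici]
      split_ifs with h
      · exact iff_of_false (by rwa [ENNReal.ofReal_le_ofReal_iff hs, not_le]) (not_le.2 h)
      · exact iff_of_true zero_le (not_lt.1 h)
    rw [this, csInf_Ici]
  · rw [indicator_of_notMem (by simpa using hsb)]
    refine le_antisymm (sInf_le ?_) (zero_le)
    rw [mem_ofPred_eq]
    split_ifs
    · exact ENNReal.ofReal_le_ofReal (not_lt.1 hsb)
    · exact zero_le

theorem setLIntegral_rearrangement_indicator (c b t : ℝ) :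
    ∫⁻ s in Ioc 0 t, rearrangement ((Ioc 0 b).indicator fun _ => (c : ℂ)) s =
      ‖(c : ℂ)‖ₑ * ENNReal.ofReal (min t b) := by
  rw [setLIntegral_congr_fun measurableSet_Ioc
    (g := (Iio b).indicator fun _ => ‖(c : ℂ)‖ₑ) fun s hs => rearrangement_indicator hs.1.le,
    lintegral_indicator measurableSet_Iio, setLIntegral_const,
    Measure.restrict_apply measurableSet_Iio]
  congr 1
  refine le_antisymm ?_ ?_
  · refine (measure_mono (t := Ioc 0 (min t b)) fun s hs => ⟨hs.2.1, le_min hs.2.2 hs.1.le⟩).trans ?_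
    simp
  · refine le_trans ?_ (measure_mono (s := Ioo 0 (min t b)) fun s hs =>
      ⟨hs.2.trans_le (min_le_right _ _), hs.1, hs.2.le.trans (min_le_left _ _)⟩)
    simp

theorem IsOmega.ratio_le_max {ψ : ℝ → ℝ} (hψ : IsOmega ψ) {a t : ℝ} (ha : 0 < a) (ht : 0 < t) :
    ψ (a * t) / ψ t ≤ max 1 a := by
  rw [div_le_iff₀ (hψ.pos ht)]
  rcases le_or_gt a 1 with h | h
  · rw [max_eq_left h, one_mul]
    exact hψ.monotoneOn (mul_pos ha ht).le ht.le (mul_le_of_le_one_left ht.le h)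
  · rw [max_eq_right h.le]
    exact hψ.map_mul_le h ht.le

/-- The integral up to `t` is (ψ(b)/b) min(t, b), which is at most ψ(t) because ψ(t) increases and
ψ(t)/t decreases. These are the test functions for the dilation norm. -/
theorem IsOmega.lorentzNorm_indicator_le {ψ : ℝ → ℝ} (hψ : IsOmega ψ) {b : ℝ} (hb : 0 < b) :
    lorentzNorm ψ ((Ioc 0 b).indicator fun _ => ((ψ b / b : ℝ) : ℂ)) ≤ 1 := by
  refine iSup₂_le fun t ht => ?_
  rw [setLIntegral_rearrangement_indicator, ENNReal.div_le_iff (by simpa using hψ.pos ht)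
    ENNReal.ofReal_ne_top, one_mul, ← ofReal_norm, Complex.norm_real,
    Real.norm_of_nonneg (div_pos (hψ.pos hb) hb).le, ← ENNReal.ofReal_mul (div_pos (hψ.pos hb) hb).le]
  refine ENNReal.ofReal_le_ofReal ?_
  have h := hψ.ratio_le_max (div_pos hb ht) ht
  rw [div_mul_cancel₀ _ ht.ne', div_le_iff₀ (hψ.pos ht)] at h
  rcases le_total t b with h1 | h1
  · rw [min_eq_left h1]
    rw [max_eq_right ((one_le_div ht).2 h1)] at h
    calc ψ b / b * t ≤ (b / t * ψ t) / b * t := by gcongr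
      _ = ψ t := by field_simp
  · rw [min_eq_right h1, div_mul_cancel₀ _ hb.ne']
    rwa [max_eq_left ((div_le_one ht).2 h1), one_mul] at h

/-- The dilation function `a ↦ sup_{t > 0} ψ(at) / ψ(t)`. -/
noncomputable def dilationSup (ψ : ℝ → ℝ) (a : ℝ) : ℝ :=
  sSup ((fun t => ψ (a * t) / ψ t) '' Ioi 0)

theorem IsOmega.isLUB_dilationSup {ψ : ℝ → ℝ} (hψ : IsOmega ψ) {a : ℝ} (ha : 0 < a) :
    IsLUB ((fun t => ψ (a * t) / ψ t) '' Ioi 0) (dilationSup ψ a) :=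
  isLUB_csSup (nonempty_Ioi.image _)
    ⟨max 1 a, forall_mem_image.2 fun _ ht => hψ.ratio_le_max ha ht⟩

theorem IsOmega.ratio_le_dilationSup {ψ : ℝ → ℝ} (hψ : IsOmega ψ) {a t : ℝ} (ha : 0 < a)
    (ht : 0 < t) : ψ (a * t) / ψ t ≤ dilationSup ψ a :=
  (hψ.isLUB_dilationSup ha).1 (mem_image_of_mem _ ht)

theorem IsOmega.dilationSup_le {ψ : ℝ → ℝ} (hψ : IsOmega ψ) {a m : ℝ} (ha : 0 < a)
    (h : ∀ t, 0 < t → ψ (a * t) / ψ t ≤ m) : dilationSup ψ a ≤ m :=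
  (hψ.isLUB_dilationSup ha).2 (forall_mem_image.2 h)

theorem IsOmega.dilationSup_pos {ψ : ℝ → ℝ} (hψ : IsOmega ψ) {a : ℝ} (ha : 0 < a) :
    0 < dilationSup ψ a :=
  (div_pos (hψ.pos (mul_pos ha one_pos)) (hψ.pos one_pos)).trans_le
    (hψ.ratio_le_dilationSup ha one_pos)

/-- The lower bound comes from the normalized indicator of (0, at], with the Lorentz quotient of its
dilate evaluated at `t`. -/
theorem IsOmega.dilationNorm_eq {ψ : ℝ → ℝ} (hψ : IsOmega ψ) {a : ℝ} (ha : 0 < a) :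
    dilationNorm (lorentzNorm ψ) a = ENNReal.ofReal (dilationSup ψ a / a) := by
  refine le_antisymm (iSup_le fun f => iSup₂_le fun _ hf =>
    hψ.lorentzNorm_dilate_le ha (fun t ht => hψ.ratio_le_dilationSup ha ht) hf) ?_
  have key : ∀ t, 0 < t →
      ENNReal.ofReal (ψ (a * t) / ψ t / a) ≤ dilationNorm (lorentzNorm ψ) a := by
    intro t ht
    have hat : 0 < a * t := mul_pos ha ht
    have hc : 0 < ψ (a * t) / (a * t) := div_pos (hψ.pos hat) hat
    unfold dilationNorm
    refine le_trans ?_ (le_iSup_of_le ((Ioc 0 (a * t)).indicator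
      fun _ => ((ψ (a * t) / (a * t) : ℝ) : ℂ)) (le_iSup₂_of_le
      (aestronglyMeasurable_const.indicator measurableSet_Ioc)
      (hψ.lorentzNorm_indicator_le hat) le_rfl))
    rw [lorentzNorm_dilate ha]
    refine le_iSup₂_of_le t ht ?_
    rw [setLIntegral_rearrangement_indicator, min_self, ← ofReal_norm, Complex.norm_real,
      Real.norm_of_nonneg hc.le, ← ENNReal.ofReal_mul hc.le,
      ← ENNReal.ofReal_mul (inv_nonneg.2 ha.le), ← ENNReal.ofReal_div_of_pos (hψ.pos ht)]
    refine ENNReal.ofReal_le_ofReal (le_of_eq ?_)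
    field_simp
  rcases eq_or_ne (dilationNorm (lorentzNorm ψ) a) ∞ with h | h
  · rw [h]
    exact le_top
  · rw [← ENNReal.ofReal_toReal h]
    refine ENNReal.ofReal_le_ofReal ?_
    rw [div_le_iff₀ ha]
    refine hψ.dilationSup_le ha fun t ht => ?_
    rw [← div_le_iff₀ ha]
    exact (ENNReal.ofReal_le_iff_le_toReal h).1 (key t ht)

theorem IsOmega.dilationNorm_toReal {ψ : ℝ → ℝ} (hψ : IsOmega ψ) {a : ℝ} (ha : 0 < a) :
    (dilationNorm (lorentzNorm ψ) a).toReal = dilationSup ψ a / a := by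
  rw [hψ.dilationNorm_eq ha, ENNReal.toReal_ofReal (div_pos (hψ.dilationSup_pos ha) ha).le]

/-! ### Boyd indices in terms of the dilation function. -/

/-- For y ≤ 0 the quotient is ∞, so the hypothesis already excludes that case. -/
theorem lt_mul_of_ofReal_div_lt {x y K : ℝ} (hx : 0 < x)
    (h : ENNReal.ofReal x / ENNReal.ofReal y < ENNReal.ofReal K) : x < K * y := by
  rcases le_or_gt y 0 with hy | hy
  · rw [ENNReal.ofReal_of_nonpos hy, ENNReal.div_zero (by simpa using hx)] at h
    exact absurd h not_top_lt
  · rw [← ENNReal.ofReal_div_of_pos hy] at h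
    exact (div_lt_iff₀ hy).1 (ENNReal.ofReal_lt_ofReal_iff'.1 h).1

theorem IsOmega.dilationSup_mul_le {ψ : ℝ → ℝ} (hψ : IsOmega ψ) {a b : ℝ} (ha : 0 < a)
    (hb : 0 < b) : dilationSup ψ (a * b) ≤ dilationSup ψ a * dilationSup ψ b := by
  refine hψ.dilationSup_le (mul_pos ha hb) fun t ht => ?_
  have hbt : 0 < b * t := mul_pos hb ht
  have e : ψ (a * b * t) / ψ t = ψ (a * (b * t)) / ψ (b * t) * (ψ (b * t) / ψ t) := by
    rw [div_mul_div_cancel₀ (hψ.pos hbt).ne', mul_assoc]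
  rw [e]
  exact mul_le_mul (hψ.ratio_le_dilationSup ha hbt) (hψ.ratio_le_dilationSup hb ht)
    (div_pos (hψ.pos hbt) (hψ.pos ht)).le (hψ.dilationSup_pos ha).le

theorem IsOmega.dilationSup_one {ψ : ℝ → ℝ} (hψ : IsOmega ψ) : dilationSup ψ 1 = 1 := by
  refine le_antisymm (hψ.dilationSup_le one_pos fun t ht => ?_) ?_
  · rw [one_mul, div_self (hψ.pos ht).ne']
  · have h := hψ.ratio_le_dilationSup one_pos one_pos
    rwa [one_mul, div_self (hψ.pos one_pos).ne'] at h

theorem IsOmega.dilationSup_pow_le {ψ : ℝ → ℝ} (hψ : IsOmega ψ) {a : ℝ} (ha : 0 < a) (n : ℕ) :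
    dilationSup ψ (a ^ n) ≤ dilationSup ψ a ^ n := by
  induction n with
  | zero => simp [hψ.dilationSup_one]
  | succ n ih =>
    rw [pow_succ, pow_succ]
    exact (hψ.dilationSup_mul_le (pow_pos ha n) ha).trans
      (mul_le_mul_of_nonneg_right ih (hψ.dilationSup_pos ha).le)

theorem IsOmega.dilationSup_le_max {ψ : ℝ → ℝ} (hψ : IsOmega ψ) {a : ℝ} (ha : 0 < a) :
    dilationSup ψ a ≤ max 1 a :=
  hψ.dilationSup_le ha fun _ ht => hψ.ratio_le_max ha ht

theorem IsOmega.one_le_dilationSup {ψ : ℝ → ℝ} (hψ : IsOmega ψ) {a : ℝ} (ha : 1 ≤ a) :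
    1 ≤ dilationSup ψ a := by
  refine le_trans ?_ (hψ.ratio_le_dilationSup (one_pos.trans_le ha) one_pos)
  rw [one_le_div (hψ.pos one_pos), mul_one]
  exact hψ.monotoneOn (mem_Ici.2 zero_le_one) (mem_Ici.2 (zero_le_one.trans ha)) ha

/-- A single a < 1 with M(a) < 1 is enough to keep the quotient away from 1: M(aⁿ) ≤ M(a)ⁿ bounds it
below along the sequence aⁿ → 0. -/
theorem IsOmega.hasLowerBoydIndex_one_iff {ψ : ℝ → ℝ} (hψ : IsOmega ψ) :
    HasLowerBoydIndex (lorentzNorm ψ) 1 ↔ ∀ a, 0 < a → a < 1 → dilationSup ψ a = 1 := by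
  constructor
  · intro h a ha ha1
    refine le_antisymm (by simpa [ha1.le] using hψ.dilationSup_le_max ha) (not_lt.1 fun hlt => ?_)
    have hL : 0 < Real.log a⁻¹ := Real.log_pos ((one_lt_inv₀ ha).2 ha1)
    have hl : 0 < -Real.log (dilationSup ψ a) :=
      neg_pos.2 (Real.log_neg (hψ.dilationSup_pos ha) hlt)
    set L := Real.log a⁻¹ with hLdef
    set l := -Real.log (dilationSup ψ a) with hldef
    -- The threshold is chosen so that (1 + l/L)(L − l) = L − l²/L < L, which contradicts a quotient
    -- below it.
    have hK : (1 : ℝ≥0∞) < ENNReal.ofReal (1 + l / L) := by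
      rw [ENNReal.one_lt_ofReal]
      linarith [div_pos hl hL]
    have hseq : Tendsto (fun n : ℕ => a ^ n) atTop (𝓝[>] 0) :=
      tendsto_nhdsWithin_iff.2 ⟨tendsto_pow_atTop_nhds_zero_of_lt_one ha.le ha1,
        Eventually.of_forall fun n => pow_pos ha n⟩
    obtain ⟨n, hn, hn0⟩ :=
      ((hseq.eventually (h.eventually_lt_const hK)).and (eventually_gt_atTop 0)).exists
    have hn' : (0 : ℝ) < n := Nat.cast_pos.2 hn0
    have hpow : 0 < a ^ n := pow_pos ha n
    have h1 : Real.log (a ^ n)⁻¹ = n * L := by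
      rw [← inv_pow, Real.log_pow]
    have h2 : Real.log (dilationNorm (lorentzNorm ψ) (a ^ n)).toReal ≤ n * (L - l) := by
      rw [hψ.dilationNorm_toReal hpow, Real.log_div (hψ.dilationSup_pos hpow).ne' hpow.ne']
      have h3 := Real.log_le_log (hψ.dilationSup_pos hpow) (hψ.dilationSup_pow_le ha n)
      rw [Real.log_pow] at h3
      rw [Real.log_inv] at h1
      rw [hldef]
      linarith
    have h4 := lt_mul_of_ofReal_div_lt (by rw [h1]; positivity) hn
    rw [h1] at h4
    have h5 : n * L < (1 + l / L) * (n * (L - l)) :=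
      h4.trans_le (mul_le_mul_of_nonneg_left h2 (by positivity))
    have h6 : (1 + l / L) * (n * (L - l)) = n * L - n * (l ^ 2 / L) := by
      field_simp
      ring
    have h7 : 0 < n * (l ^ 2 / L) := by positivity
    linarith
  · intro h
    refine Tendsto.congr' ?_ tendsto_const_nhds
    filter_upwards [Ioo_mem_nhdsGT (zero_lt_one' ℝ)] with a ha
    rw [hψ.dilationNorm_toReal ha.1, h a ha.1 ha.2, one_div, ENNReal.div_self _ ENNReal.ofReal_ne_top]
    simpa using Real.log_pos ((one_lt_inv₀ ha.1).2 ha.2)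

/-- For a > 1 the quotient is log a / (log a − log M(a)), so it tends to 1 exactly when log M(a) /
log a tends to 0. -/
theorem IsOmega.hasUpperBoydIndex_one_iff {ψ : ℝ → ℝ} (hψ : IsOmega ψ) :
    HasUpperBoydIndex (lorentzNorm ψ) 1 ↔
      ∀ c, 0 < c → ∀ᶠ a in atTop, Real.log (dilationSup ψ a) ≤ c * Real.log a := by
  have hlog : ∀ a : ℝ, 1 < a → -Real.log (dilationNorm (lorentzNorm ψ) a).toReal =
      Real.log a - Real.log (dilationSup ψ a) := fun a ha => by
    have ha0 : 0 < a := one_pos.trans ha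
    rw [hψ.dilationNorm_toReal ha0, Real.log_div (hψ.dilationSup_pos ha0).ne' ha0.ne', neg_sub]
  constructor
  · intro h c hc
    have hK : (1 : ℝ≥0∞) < ENNReal.ofReal (1 + c) := by
      rw [ENNReal.one_lt_ofReal]
      linarith
    filter_upwards [h.eventually_lt_const hK, eventually_gt_atTop 1] with a h1 ha
    rw [hlog a ha, Real.log_inv, neg_neg] at h1
    have h2 := lt_mul_of_ofReal_div_lt (Real.log_pos ha) h1
    -- From log a < (1 + c)(log a − log M(a)) one gets (1 + c) log M(a) < c log a; the surplus c log
    -- M(a) is dropped by its sign.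
    have h3 : 0 ≤ c * Real.log (dilationSup ψ a) :=
      mul_nonneg hc.le (Real.log_nonneg (hψ.one_le_dilationSup ha.le))
    linarith
  · intro h
    have h0 : Tendsto (fun a => Real.log (dilationSup ψ a) / Real.log a) atTop (𝓝 0) := by
      rw [Metric.tendsto_nhds]
      intro ε hε
      filter_upwards [h (ε / 2) (half_pos hε), eventually_gt_atTop 1] with a h1 ha
      rw [Real.dist_0_eq_abs, abs_of_nonneg (div_nonneg
        (Real.log_nonneg (hψ.one_le_dilationSup ha.le)) (Real.log_pos ha).le)]
      exact ((div_le_iff₀ (Real.log_pos ha)).2 h1).trans_lt (half_lt_self hε)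
    have h1 : Tendsto (fun a => (1 - Real.log (dilationSup ψ a) / Real.log a)⁻¹) atTop (𝓝 1) := by
      simpa using (tendsto_const_nhds.sub h0).inv₀ (by simp : (1 : ℝ) - 0 ≠ 0)
    have h2 := ENNReal.tendsto_ofReal h1
    rw [ENNReal.ofReal_one] at h2
    refine Tendsto.congr' ?_ h2
    filter_upwards [h0.eventually_lt_const one_pos, eventually_gt_atTop 1] with a h3 ha
    have hL := Real.log_pos ha
    rw [div_lt_one hL] at h3
    rw [hlog a ha, Real.log_inv, neg_neg, ← ENNReal.ofReal_div_of_pos (by linarith)]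
    congr 1
    rw [one_sub_div hL.ne', inv_div]

/-! ### Logarithmic means and their dilation invariant limits. -/

theorem ae_norm_le_norm_Lp_top (f : LInftyHalfLine) : ∀ᵐ t ∂halfLine, ‖f t‖ ≤ ‖f‖ := by
  have hlt : eLpNormEssSup f halfLine ≠ ∞ := by
    simpa [eLpNorm_exponent_top] using (Lp.memLp f).2.ne
  filter_upwards [enorm_ae_le_eLpNormEssSup f halfLine] with t ht
  rw [Lp.norm_def, eLpNorm_exponent_top]
  simpa using ENNReal.toReal_mono hlt ht

theorem integrable_Lp_top {P : Measure ℝ} [IsFiniteMeasure P] (hP : P ≪ halfLine)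
    (f : LInftyHalfLine) : Integrable f P :=
  Integrable.of_bound ((Lp.aestronglyMeasurable f).mono_ac hP) ‖f‖
    (hP.ae_le (ae_norm_le_norm_Lp_top f))

theorem norm_integral_Lp_top_le {P : Measure ℝ} [IsProbabilityMeasure P] (hP : P ≪ halfLine)
    (f : LInftyHalfLine) : ‖∫ t, f t ∂P‖ ≤ 1 * ‖f‖ := by
  have h := norm_integral_le_of_norm_le_const (hP.ae_le (ae_norm_le_norm_Lp_top f))
  simpa using h

/-- The state `f ↦ ∫ f dP` given by a probability measure `P` that is absolutely continuous with
respect to Lebesgue measure. -/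
noncomputable def expectationState (P : Measure ℝ) [IsProbabilityMeasure P] (hP : P ≪ halfLine) :
    LInftyHalfLine →L[ℂ] ℂ :=
  LinearMap.mkContinuous
    { toFun := fun f => ∫ t, f t ∂P
      map_add' := fun f g => by
        rw [← integral_add (integrable_Lp_top hP f) (integrable_Lp_top hP g)]
        exact integral_congr_ae (hP.ae_le (Lp.coeFn_add f g))
      map_smul' := fun c f => by
        rw [RingHom.id_apply, ← integral_smul]
        exact integral_congr_ae (hP.ae_le (Lp.coeFn_smul c f)) }
    1 (norm_integral_Lp_top_le hP)

theorem expectationState_toLp {P : Measure ℝ} [IsProbabilityMeasure P] (hP : P ≪ halfLine)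
    {f : ℝ → ℂ} (hf : MemLp f ∞ halfLine) :
    expectationState P hP hf.toLp = ∫ t, f t ∂P :=
  integral_congr_ae (hP.ae_le hf.coeFn_toLp)

theorem norm_expectationState_le {P : Measure ℝ} [IsProbabilityMeasure P] (hP : P ≪ halfLine) :
    ‖expectationState P hP‖ ≤ 1 :=
  LinearMap.mkContinuous_norm_le _ zero_le_one _

theorem isState_expectationState {P : Measure ℝ} [IsProbabilityMeasure P] (hP : P ≪ halfLine) :
    IsState (expectationState P hP) where
  nonneg f hf := integral_nonneg_of_ae (hP.ae_le hf)
  map_one := by simp [expectationState_toLp]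

/-- The probability measure with density `1 / (s log R)` on `(t, Rt]`. -/
noncomputable def logMeasure (t R : ℝ) : Measure ℝ :=
  (volume.restrict (Ioc t (R * t))).withDensity fun s => ENNReal.ofReal (s⁻¹ / Real.log R)

theorem logMeasure_ac {t R : ℝ} (ht : 0 < t) : logMeasure t R ≪ halfLine :=
  (withDensity_absolutelyContinuous _ _).trans
    (Measure.absolutelyContinuous_of_le (Measure.restrict_mono_set _ fun _ hs => ht.trans hs.1))

theorem integral_logMeasure {E : Type*} [NormedAddCommGroup E] [NormedSpace ℝ E] {t R : ℝ}
    (ht : 0 < t) (hR : 1 < R) (f : ℝ → E) :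
    ∫ s, f s ∂logMeasure t R = (Real.log R)⁻¹ • ∫ s in t..R * t, s⁻¹ • f s := by
  unfold logMeasure
  rw [integral_withDensity_eq_integral_toReal_smul (by fun_prop)
    (Eventually.of_forall fun _ => ENNReal.ofReal_lt_top),
    intervalIntegral.integral_of_le (lt_mul_of_one_lt_left ht hR).le, ← integral_smul]
  refine setIntegral_congr_fun measurableSet_Ioc fun s hs => ?_
  have hs0 : 0 < s := ht.trans hs.1
  rw [ENNReal.toReal_ofReal (div_nonneg (inv_nonneg.2 hs0.le) (Real.log_pos hR).le), smul_smul,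
    div_eq_inv_mul]

theorem intervalIntegrable_inv_pos {x y : ℝ} (hx : 0 < x) (hy : 0 < y) :
    IntervalIntegrable (fun s : ℝ => s⁻¹) volume x y :=
  intervalIntegral.intervalIntegrable_inv
    (fun _ hs => ((lt_min hx hy).trans_le hs.1).ne') continuousOn_id

theorem isProbabilityMeasure_logMeasure {t R : ℝ} (ht : 0 < t) (hR : 1 < R) :
    IsProbabilityMeasure (logMeasure t R) := by
  have hL := Real.log_pos hR
  have hRt : 0 < R * t := mul_pos (one_pos.trans hR) ht
  constructor
  unfold logMeasure
  rw [withDensity_apply _ MeasurableSet.univ, setLIntegral_univ, ← ofReal_integral_eq_lintegral_ofReal]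
  · rw [← intervalIntegral.integral_of_le (lt_mul_of_one_lt_left ht hR).le,
      intervalIntegral.integral_div, integral_inv_of_pos ht hRt, mul_div_cancel_right₀ _ ht.ne',
      div_self hL.ne', ENNReal.ofReal_one]
  · exact ((intervalIntegrable_inv_pos ht hRt).div_const _).1
  · refine (ae_restrict_iff' measurableSet_Ioc).2 (Eventually.of_forall fun s hs => ?_)
    exact div_nonneg (inv_nonneg.2 (ht.trans hs.1).le) hL.le

/-- The logarithmic mean `f ↦ (log R)⁻¹ ∫_t^{Rt} f(s) ds / s`. -/
noncomputable def logMean {t R : ℝ} (ht : 0 < t) (hR : 1 < R) : LInftyHalfLine →L[ℂ] ℂ :=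
  haveI := isProbabilityMeasure_logMeasure ht hR
  expectationState (logMeasure t R) (logMeasure_ac ht)

theorem logMean_apply {t R : ℝ} (ht : 0 < t) (hR : 1 < R) (f : LInftyHalfLine) :
    logMean ht hR f = ∫ s, f s ∂logMeasure t R := rfl

theorem logMean_toLp {t R : ℝ} (ht : 0 < t) (hR : 1 < R) {f : ℝ → ℂ}
    (hf : MemLp f ∞ halfLine) : logMean ht hR hf.toLp = ∫ s, f s ∂logMeasure t R :=
  haveI := isProbabilityMeasure_logMeasure ht hR
  expectationState_toLp (logMeasure_ac ht) hf

theorem integral_inv_smul_dilate {E : Type*} [NormedAddCommGroup E] [NormedSpace ℝ E] {a : ℝ}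
    (ha : 0 < a) (x y : ℝ) (f : ℝ → E) :
    ∫ s in x..y, s⁻¹ • f (a * s) = ∫ s in a * x..a * y, s⁻¹ • f s := by
  have h := intervalIntegral.integral_comp_mul_left (a := x) (b := y)
    (fun s => s⁻¹ • f s) ha.ne'
  rw [eq_inv_smul_iff₀ ha.ne', ← intervalIntegral.integral_smul] at h
  rw [← h]
  congr 1
  ext s
  rw [smul_smul, mul_inv, mul_inv_cancel_left₀ ha.ne']

/-- The measure ds/s is dilation invariant, so only boundary terms survive. This gives both the
asymptotic invariance of the means and the telescoping of the cocycle. -/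
theorem integral_inv_smul_dilate_sub {E : Type*} [NormedAddCommGroup E] [NormedSpace ℝ E]
    {a x y : ℝ} (ha : 0 < a) (hx : 0 < x) (hy : 0 < y) {f : ℝ → E}
    (hf : ∀ u v, 0 < u → 0 < v → IntervalIntegrable (fun s => s⁻¹ • f s) volume u v) :
    (∫ s in x..y, s⁻¹ • f (a * s)) - ∫ s in x..y, s⁻¹ • f s =
      (∫ s in y..a * y, s⁻¹ • f s) - ∫ s in x..a * x, s⁻¹ • f s := by
  have hax := mul_pos ha hx
  have hay := mul_pos ha hy
  rw [integral_inv_smul_dilate ha,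
    intervalIntegral.integral_interval_sub_interval_comm' (hf _ _ hax hay) (hf _ _ hx hy)
      (hf _ _ hax hx)]

theorem intervalIntegrable_inv_smul_Lp (f : LInftyHalfLine) {u v : ℝ} (hu : 0 < u) (hv : 0 < v) :
    IntervalIntegrable (fun s => s⁻¹ • f s) volume u v := by
  have hle : volume.restrict (uIoc u v) ≤ halfLine :=
    Measure.restrict_mono_set _ fun s hs => (lt_min hu hv).trans hs.1
  have h := (intervalIntegrable_inv_pos hu hv).def'
  rw [intervalIntegrable_iff]
  refine h.smul_bdd (‖f‖) ?_ ((Measure.absolutelyContinuous_of_le hle).ae_le (ae_norm_le_norm_Lp_top f))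
  exact (Lp.aestronglyMeasurable f).mono_ac (Measure.absolutelyContinuous_of_le hle)

theorem norm_integral_inv_smul_Lp_le (f : LInftyHalfLine) {u v : ℝ} (hu : 0 < u) (hv : 0 < v) :
    ‖∫ s in u..v, s⁻¹ • f s‖ ≤ |Real.log (v / u)| * ‖f‖ := by
  wlog huv : u ≤ v generalizing u v
  · have h := this hv hu (le_of_not_ge huv)
    rwa [intervalIntegral.integral_symm, norm_neg, ← inv_div, Real.log_inv, abs_neg]
  have h1 : ∀ᵐ s, s ∈ Ioc u v → ‖s⁻¹ • f s‖ ≤ s⁻¹ * ‖f‖ := by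
    have h2 := (ae_restrict_iff' measurableSet_Ioi).1 (ae_norm_le_norm_Lp_top f)
    filter_upwards [h2] with s hs hsu
    have hs0 : 0 < s := hu.trans hsu.1
    rw [norm_smul, Real.norm_of_nonneg (inv_nonneg.2 hs0.le)]
    exact mul_le_mul_of_nonneg_left (hs hs0) (inv_nonneg.2 hs0.le)
  refine (intervalIntegral.norm_integral_le_of_norm_le huv h1
    ((intervalIntegrable_inv_pos hu hv).mul_const _)).trans ?_
  rw [intervalIntegral.integral_mul_const, integral_inv_of_pos hu hv]
  exact mul_le_mul_of_nonneg_right (le_abs_self _) (norm_nonneg _)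

/-- Each of the two boundary intervals has ds/s-length |log a|, whatever `R` is. -/
theorem norm_logMean_dilate_sub_le {t R a : ℝ} (ht : 0 < t) (hR : 1 < R) (ha : 0 < a)
    (f : LInftyHalfLine) :
    ‖logMean ht hR (dilateLp ha f) - logMean ht hR f‖ ≤
      (Real.log R)⁻¹ * (2 * |Real.log a| * ‖f‖) := by
  have hRt : 0 < R * t := mul_pos (one_pos.trans hR) ht
  have hL := Real.log_pos hR
  rw [dilateLp, logMean_toLp, logMean_apply, integral_logMeasure ht hR, integral_logMeasure ht hR,
    ← smul_sub, integral_inv_smul_dilate_sub ha ht hRt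
      fun u v hu hv => intervalIntegrable_inv_smul_Lp f hu hv, norm_smul,
    Real.norm_of_nonneg (inv_nonneg.2 hL.le)]
  refine mul_le_mul_of_nonneg_left ?_ (inv_nonneg.2 hL.le)
  have h1 := norm_integral_inv_smul_Lp_le f hRt (mul_pos ha hRt)
  have h2 := norm_integral_inv_smul_Lp_le f ht (mul_pos ha ht)
  rw [mul_div_cancel_right₀ _ hRt.ne'] at h1
  rw [mul_div_cancel_right₀ _ ht.ne'] at h2
  refine (norm_sub_le _ _).trans ?_
  linarith

/-- Along an ultrafilter, logarithmic means over intervals `(t, Rt]` with `R → ∞` converge to a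
dilation invariant state. -/
theorem exists_tendsto_logMean {t R : ℕ → ℝ} (ht : ∀ n, 0 < t n) (hR : ∀ n, 1 < R n)
    (hRt : Tendsto R atTop atTop) :
    ∃ ω : LInftyHalfLine →L[ℂ] ℂ, IsState ω ∧ IsDilationInvariant ω ∧
      ∀ f, Tendsto (fun n => logMean (ht n) (hR n) f) (hyperfilter ℕ : Filter ℕ) (𝓝 (ω f)) := by
  let Ω : ℕ → WeakDual ℂ LInftyHalfLine := fun n =>
    StrongDual.toWeakDual (logMean (ht n) (hR n))
  have hmem : ∀ n, Ω n ∈ WeakDual.toStrongDual ⁻¹'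
      Metric.closedBall (0 : StrongDual ℂ LInftyHalfLine) 1 := by
    intro n
    have := isProbabilityMeasure_logMeasure (ht n) (hR n)
    rw [mem_preimage, mem_closedBall_zero_iff]
    exact norm_expectationState_le (logMeasure_ac (ht n))
  -- Banach–Alaoglu; `L^∞` is not separable, so the limit is taken along an ultrafilter rather than
  -- a subsequence.
  obtain ⟨ω, -, hω⟩ := (WeakDual.isCompact_closedBall (𝕜 := ℂ) (E := LInftyHalfLine) 0 1)
    |>.ultrafilter_le_nhds ((hyperfilter ℕ).map Ω)
    (le_principal_iff.2 (mem_map.2 (Eventually.of_forall hmem)))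
  have hlim : ∀ f, Tendsto (fun n => logMean (ht n) (hR n) f) (hyperfilter ℕ : Filter ℕ)
      (𝓝 (WeakDual.toStrongDual ω f)) := fun f =>
    ((WeakDual.eval_continuous f).tendsto ω).comp hω
  have hstate : ∀ n, IsState (logMean (ht n) (hR n)) := fun n =>
    haveI := isProbabilityMeasure_logMeasure (ht n) (hR n)
    isState_expectationState (logMeasure_ac (ht n))
  refine ⟨WeakDual.toStrongDual ω, ⟨fun f hf => ?_, ?_⟩, fun a ha f => ?_, hlim⟩
  · exact ge_of_tendsto' (hlim f) fun n => (hstate n).nonneg f hf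
  · refine tendsto_nhds_unique (hlim _) ?_
    simp_rw [(hstate _).map_one]
    exact tendsto_const_nhds
  · rw [← sub_eq_zero]
    refine tendsto_nhds_unique ((hlim _).sub (hlim _)) ?_
    refine squeeze_zero_norm (fun n => norm_logMean_dilate_sub_le (ht n) (hR n) ha f) ?_
    have h := ((tendsto_inv_atTop_zero.comp (Real.tendsto_log_atTop.comp hRt)).mul_const
      (2 * |Real.log a| * ‖f‖)).mono_left Nat.hyperfilter_le_atTop
    rwa [zero_mul] at h

/-! ### Values of states on the dilation cocycle. -/

theorem IsState.mono {ω : LInftyHalfLine →L[ℂ] ℂ} (hω : IsState ω) {f g : ℝ → ℝ}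
    (hf : MemLp (fun t => (f t : ℂ)) ∞ halfLine) (hg : MemLp (fun t => (g t : ℂ)) ∞ halfLine)
    (h : ∀ t, 0 < t → f t ≤ g t) : ω hf.toLp ≤ ω hg.toLp := by
  rw [← sub_nonneg, ← map_sub, ← MemLp.toLp_sub]
  refine hω.nonneg _ ?_
  filter_upwards [(hg.sub hf).coeFn_toLp, ae_restrict_mem measurableSet_Ioi] with t h1 ht
  rw [h1, Pi.sub_apply, sub_nonneg]
  exact_mod_cast h t ht

theorem memLp_ofReal_const (c : ℝ) : MemLp (fun _ : ℝ => (c : ℂ)) ∞ halfLine :=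
  memLp_top_const _

theorem IsState.map_const {ω : LInftyHalfLine →L[ℂ] ℂ} (hω : IsState ω) (c : ℝ) :
    ω (memLp_ofReal_const c).toLp = c := by
  have h : (memLp_ofReal_const c).toLp = (c : ℂ) • memLp_one_halfLine.toLp := by
    rw [← MemLp.toLp_const_smul]
    refine MemLp.toLp_congr _ _ (Eventually.of_forall fun t => ?_)
    simp
  rw [h, map_smul, hω.map_one, smul_eq_mul, mul_one]

/-- The dilation cocycle `log (ψ(at) / ψ(t))` of `ψ`. -/
noncomputable def logRatio (ψ : ℝ → ℝ) (a t : ℝ) : ℝ :=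
  Real.log (ψ (a * t)) - Real.log (ψ t)

theorem IsOmega.monotoneOn_log {ψ : ℝ → ℝ} (hψ : IsOmega ψ) :
    MonotoneOn (fun t => Real.log (ψ t)) (Ioi 0) := fun _ hs _ ht hst =>
  Real.log_le_log (hψ.pos hs)
    (hψ.monotoneOn (mem_Ici.2 (le_of_lt hs)) (mem_Ici.2 (le_of_lt ht)) hst)

theorem IsOmega.logRatio_eq {ψ : ℝ → ℝ} (hψ : IsOmega ψ) {a t : ℝ} (ha : 0 < a) (ht : 0 < t) :
    logRatio ψ a t = Real.log (ψ (a * t) / ψ t) :=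
  (Real.log_div (hψ.pos (mul_pos ha ht)).ne' (hψ.pos ht).ne').symm

theorem IsOmega.one_le_ratio {ψ : ℝ → ℝ} (hψ : IsOmega ψ) {a t : ℝ} (ha : 1 < a) (ht : 0 < t) :
    1 ≤ ψ (a * t) / ψ t := by
  rw [one_le_div (hψ.pos ht)]
  exact hψ.monotoneOn (mem_Ici.2 ht.le) (mem_Ici.2 (mul_pos (one_pos.trans ha) ht).le)
    (lt_mul_of_one_lt_left ht ha).le

theorem IsOmega.ratio_le {ψ : ℝ → ℝ} (hψ : IsOmega ψ) {a t : ℝ} (ha : 1 < a) (ht : 0 < t) :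
    ψ (a * t) / ψ t ≤ a :=
  (hψ.ratio_le_max (one_pos.trans ha) ht).trans_eq (max_eq_right ha.le)

theorem IsOmega.logRatio_nonneg {ψ : ℝ → ℝ} (hψ : IsOmega ψ) {a t : ℝ} (ha : 1 < a)
    (ht : 0 < t) : 0 ≤ logRatio ψ a t := by
  rw [hψ.logRatio_eq (one_pos.trans ha) ht]
  exact Real.log_nonneg (hψ.one_le_ratio ha ht)

theorem IsOmega.logRatio_le_log {ψ : ℝ → ℝ} (hψ : IsOmega ψ) {a t : ℝ} (ha : 1 < a)
    (ht : 0 < t) : logRatio ψ a t ≤ Real.log a := by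
  rw [hψ.logRatio_eq (one_pos.trans ha) ht]
  exact Real.log_le_log (one_pos.trans_le (hψ.one_le_ratio ha ht)) (hψ.ratio_le ha ht)

theorem IsOmega.memLp_logRatio {ψ : ℝ → ℝ} (hψ : IsOmega ψ) {a : ℝ} (ha : 1 < a) :
    MemLp (fun t => (logRatio ψ a t : ℂ)) ∞ halfLine := by
  have h1 : AEMeasurable (fun t => Real.log (ψ t)) halfLine :=
    aemeasurable_restrict_of_monotoneOn measurableSet_Ioi hψ.monotoneOn_log
  have h2 : AEMeasurable (fun t => Real.log (ψ (a * t))) halfLine :=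
    h1.comp_quasiMeasurePreserving (quasiMeasurePreserving_dilate (one_pos.trans ha))
  refine memLp_top_of_bound (C := Real.log a)
    (Complex.measurable_ofReal.comp_aemeasurable (h2.sub h1)).aestronglyMeasurable ?_
  refine (ae_restrict_iff' measurableSet_Ioi).2 (Eventually.of_forall fun t ht => ?_)
  rw [Complex.norm_real, Real.norm_of_nonneg (hψ.logRatio_nonneg ha ht)]
  exact hψ.logRatio_le_log ha ht

theorem IsOmega.map_logRatio_nonneg {ψ : ℝ → ℝ} (hψ : IsOmega ψ) {ω : LInftyHalfLine →L[ℂ] ℂ}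
    (hω : IsState ω) {a : ℝ} (ha : 1 < a) : 0 ≤ ω (hψ.memLp_logRatio ha).toLp := by
  have h := hω.mono (memLp_ofReal_const 0) (hψ.memLp_logRatio ha)
    fun t ht => hψ.logRatio_nonneg ha ht
  rwa [hω.map_const, Complex.ofReal_zero] at h

/-- For x in [1, a] one has log x ≤ x − 1 ≤ a log x; apply the state with x = ψ(at)/ψ(t). -/
theorem IsOmega.map_ratio_eq_one_iff {ψ : ℝ → ℝ} (hψ : IsOmega ψ) {ω : LInftyHalfLine →L[ℂ] ℂ}
    (hω : IsState ω) {a : ℝ} (ha : 1 < a) :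
    ω (hψ.memLp_ratio ha).toLp = 1 ↔ ω (hψ.memLp_logRatio ha).toLp = 0 := by
  have ha0 : 0 < a := one_pos.trans ha
  constructor
  · intro h
    refine le_antisymm ?_ (hψ.map_logRatio_nonneg hω ha)
    have hm : MemLp (fun t => ((ψ (a * t) / ψ t - 1 : ℝ) : ℂ)) ∞ halfLine := by
      convert (hψ.memLp_ratio ha).sub memLp_one_halfLine using 2 with t
      simp
    have h1 := hω.mono (hψ.memLp_logRatio ha) hm fun t ht => by
      rw [hψ.logRatio_eq ha0 ht]
      exact Real.log_le_sub_one_of_pos (one_pos.trans_le (hψ.one_le_ratio ha ht))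
    have h2 : hm.toLp = (hψ.memLp_ratio ha).toLp - memLp_one_halfLine.toLp := by
      rw [← MemLp.toLp_sub]
      refine MemLp.toLp_congr _ _ (Eventually.of_forall fun t => ?_)
      simp
    rwa [h2, map_sub, h, hω.map_one, sub_self] at h1
  · intro h
    have h0 := hω.mono (memLp_ofReal_const 1) (hψ.memLp_ratio ha)
      fun t ht => hψ.one_le_ratio ha ht
    rw [hω.map_const, Complex.ofReal_one] at h0
    refine le_antisymm ?_ h0
    have hm : MemLp (fun t => ((1 + a * logRatio ψ a t : ℝ) : ℂ)) ∞ halfLine := by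
      convert memLp_one_halfLine.add ((hψ.memLp_logRatio ha).const_smul (a : ℂ)) using 2 with t
      simp
    have h1 := hω.mono (hψ.memLp_ratio ha) hm fun t ht => by
      have hr1 := hψ.one_le_ratio ha ht
      have hr2 := hψ.ratio_le ha ht
      have hr0 : 0 < ψ (a * t) / ψ t := one_pos.trans_le hr1
      have h3 := Real.one_sub_inv_le_log_of_pos hr0
      have h4 := hψ.logRatio_nonneg ha ht
      rw [hψ.logRatio_eq ha0 ht] at h4 ⊢
      have h5 := mul_le_mul_of_nonneg_left h3 hr0.le
      rw [mul_sub, mul_one, mul_inv_cancel₀ hr0.ne'] at h5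
      linarith [mul_le_mul_of_nonneg_right hr2 h4]
    have h2 : hm.toLp =
        memLp_one_halfLine.toLp + (a : ℂ) • (hψ.memLp_logRatio ha).toLp := by
      rw [← MemLp.toLp_const_smul, ← MemLp.toLp_add]
      refine MemLp.toLp_congr _ _ (Eventually.of_forall fun t => ?_)
      simp
    rwa [h2, map_add, map_smul, h, hω.map_one, smul_zero, add_zero] at h1

theorem logRatio_mul (ψ : ℝ → ℝ) (a b t : ℝ) :
    logRatio ψ (a * b) t = logRatio ψ a (b * t) + logRatio ψ b t := by
  unfold logRatio
  rw [mul_assoc]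
  ring

/-- The cocycle identity `logRatio_mul` contains a term dilated by `b`, and invariance removes that
dilation. -/
theorem IsOmega.map_logRatio_mul {ψ : ℝ → ℝ} (hψ : IsOmega ψ) {ω : LInftyHalfLine →L[ℂ] ℂ}
    (hinv : IsDilationInvariant ω) {a b : ℝ} (ha : 1 < a) (hb : 1 < b) (hab : 1 < a * b) :
    ω (hψ.memLp_logRatio hab).toLp =
      ω (hψ.memLp_logRatio ha).toLp + ω (hψ.memLp_logRatio hb).toLp := by
  have hb0 : 0 < b := one_pos.trans hb
  rw [← hinv b hb0 (hψ.memLp_logRatio ha).toLp, ← map_add, dilateLp, ← MemLp.toLp_add]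
  congr 1
  refine MemLp.toLp_congr _ _ ?_
  filter_upwards [(quasiMeasurePreserving_dilate hb0).ae (hψ.memLp_logRatio ha).coeFn_toLp]
    with t ht
  rw [Pi.add_apply, ht, logRatio_mul, Complex.ofReal_add]

/-- The exponent is n + 1 since `memLp_logRatio` is available only for dilations greater than 1. -/
theorem IsOmega.map_logRatio_pow {ψ : ℝ → ℝ} (hψ : IsOmega ψ) {ω : LInftyHalfLine →L[ℂ] ℂ}
    (hinv : IsDilationInvariant ω) {a : ℝ} (ha : 1 < a) (n : ℕ) (han : 1 < a ^ (n + 1)) :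
    ω (hψ.memLp_logRatio han).toLp = ((n + 1 : ℕ) : ℂ) * ω (hψ.memLp_logRatio ha).toLp := by
  induction n with
  | zero => simp
  | succ n ih =>
    have h1 : 1 < a ^ (n + 1) := one_lt_pow₀ ha n.succ_ne_zero
    have h2 : 1 < a ^ (n + 1) * a := by rwa [← pow_succ]
    have h3 := hψ.map_logRatio_mul hinv h1 ha h2
    simp_rw [pow_succ a (n + 1)]
    rw [h3, ih h1]
    push_cast
    ring

/-! ### Compatible states and the lower index. -/

/-- If M(b) < 1, the cocycle at any power of `a` beyond b⁻¹ is bounded below by −log M(b) > 0,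
whereas additivity makes the state vanish on it. -/
theorem IsOmega.dilationSup_eq_one_of_compatible {ψ : ℝ → ℝ} (hψ : IsOmega ψ)
    {ω : LInftyHalfLine →L[ℂ] ℂ} (hω : IsState ω) (hinv : IsDilationInvariant ω)
    (hc : IsCompatible hψ ω) {b : ℝ} (hb : 0 < b) (hb1 : b < 1) : dilationSup ψ b = 1 := by
  obtain ⟨a, ha, h⟩ := hc
  rw [hψ.map_ratio_eq_one_iff hω ha] at h
  refine le_antisymm (by simpa [hb1.le] using hψ.dilationSup_le_max hb) (not_lt.1 fun hlt => ?_)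
  have hδ : 0 < -Real.log (dilationSup ψ b) :=
    neg_pos.2 (Real.log_neg (hψ.dilationSup_pos hb) hlt)
  obtain ⟨n, hn⟩ := pow_unbounded_of_one_lt b⁻¹ ha
  have han : 1 < a ^ (n + 1) := one_lt_pow₀ ha n.succ_ne_zero
  have hba : b⁻¹ ≤ a ^ (n + 1) := hn.le.trans (pow_le_pow_right₀ ha.le n.le_succ)
  have h1 := hω.mono (memLp_ofReal_const (-Real.log (dilationSup ψ b)))
    (hψ.memLp_logRatio han) fun t ht => by
      have hbt : 0 < b⁻¹ * t := mul_pos (inv_pos.2 hb) ht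
      have h2 := hψ.ratio_le_dilationSup hb hbt
      rw [mul_inv_cancel_left₀ hb.ne'] at h2
      have h3 := Real.log_le_log (div_pos (hψ.pos ht) (hψ.pos hbt)) h2
      rw [Real.log_div (hψ.pos ht).ne' (hψ.pos hbt).ne'] at h3
      have h4 : Real.log (ψ (b⁻¹ * t)) ≤ Real.log (ψ (a ^ (n + 1) * t)) :=
        hψ.monotoneOn_log hbt (mem_Ioi.2 (mul_pos (one_pos.trans han) ht))
          (mul_le_mul_of_nonneg_right hba ht.le)
      unfold logRatio
      linarith
  rw [hω.map_const, hψ.map_logRatio_pow hinv ha n han, h, mul_zero] at h1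
  have h2 : -Real.log (dilationSup ψ b) ≤ 0 := by exact_mod_cast h1
  linarith

theorem ae_logMeasure_mem (t R : ℝ) : ∀ᵐ s ∂logMeasure t R, s ∈ Ioc t (R * t) :=
  (withDensity_absolutelyContinuous _ _).ae_le (ae_restrict_mem measurableSet_Ioc)

theorem IsOmega.exists_compatible {ψ : ℝ → ℝ} (hψ : IsOmega ψ)
    (h : ∀ b, 0 < b → b < 1 → dilationSup ψ b = 1) :
    ∃ ω : LInftyHalfLine →L[ℂ] ℂ, IsState ω ∧ IsDilationInvariant ω ∧ IsCompatible hψ ω := by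
  have hR : ∀ n : ℕ, (1 : ℝ) < 2 ^ (n + 1) := fun n => one_lt_pow₀ one_lt_two n.succ_ne_zero
  -- With R = 2^(n+1), M(1/(2R)) = 1 provides an interval [t, 2Rt] on which ψ is almost constant.
  -- The extra factor 2 keeps 2s inside it for every s in (t, Rt].
  have hex : ∀ n : ℕ, ∃ t : ℝ, 0 < t ∧
      ψ (2 * (2 ^ (n + 1) * t)) ≤ (1 + 1 / ((n : ℝ) + 1)) * ψ t := by
    intro n
    have hR2 : (1 : ℝ) < 2 * 2 ^ (n + 1) := by linarith [hR n]
    have hR0 : (0 : ℝ) < 2 * 2 ^ (n + 1) := one_pos.trans hR2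
    have hn : (0 : ℝ) < 1 / ((n : ℝ) + 1) := by positivity
    have hlt : (1 + 1 / ((n : ℝ) + 1))⁻¹ < dilationSup ψ (2 * 2 ^ (n + 1))⁻¹ := by
      rw [h _ (inv_pos.2 hR0) (inv_lt_one_of_one_lt₀ hR2)]
      exact inv_lt_one_of_one_lt₀ (by linarith)
    obtain ⟨_, ⟨u, hu, rfl⟩, hu2, -⟩ :=
      (hψ.isLUB_dilationSup (inv_pos.2 hR0)).exists_between hlt
    refine ⟨(2 * 2 ^ (n + 1))⁻¹ * u, mul_pos (inv_pos.2 hR0) hu, ?_⟩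
    rw [← mul_assoc, mul_inv_cancel_left₀ hR0.ne']
    rw [lt_div_iff₀ (hψ.pos hu), inv_mul_lt_iff₀ (by positivity)] at hu2
    exact hu2.le
  choose t ht htψ using hex
  obtain ⟨ω, hω, hinv, hlim⟩ := exists_tendsto_logMean ht hR
    ((tendsto_pow_atTop_atTop_of_one_lt one_lt_two).comp (tendsto_add_atTop_nat 1))
  refine ⟨ω, hω, hinv, 2, one_lt_two, ?_⟩
  rw [← sub_eq_zero, ← hω.map_one, ← map_sub]
  refine tendsto_nhds_unique (hlim _) ?_
  refine squeeze_zero_norm (fun n => ?_)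
    (tendsto_one_div_add_atTop_nhds_zero_nat.mono_left Nat.hyperfilter_le_atTop)
  have := isProbabilityMeasure_logMeasure (ht n) (hR n)
  rw [← MemLp.toLp_sub, logMean_toLp]
  refine (norm_integral_le_of_norm_le_const (C := 1 / ((n : ℝ) + 1)) ?_).trans (by simp)
  filter_upwards [ae_logMeasure_mem (t n) (2 ^ (n + 1))] with s hs
  have hs0 : 0 < s := (ht n).trans hs.1
  have h1 := hψ.one_le_ratio one_lt_two hs0
  have h2 : ψ (2 * s) ≤ ψ (2 * (2 ^ (n + 1) * t n)) :=
    hψ.monotoneOn (mem_Ici.2 (by positivity))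
      (mem_Ici.2 (mul_pos two_pos (hs0.trans_le hs.2)).le)
      (mul_le_mul_of_nonneg_left hs.2 zero_le_two)
  have h3 : ψ (t n) ≤ ψ s := hψ.monotoneOn (mem_Ici.2 (ht n).le) (mem_Ici.2 hs0.le) hs.1.le
  have h4 : ψ (2 * s) / ψ s ≤ 1 + 1 / ((n : ℝ) + 1) := by
    rw [div_le_iff₀ (hψ.pos hs0)]
    exact h2.trans ((htψ n).trans (mul_le_mul_of_nonneg_left h3 (by positivity)))
  rw [Pi.sub_apply, ← Complex.ofReal_one, ← Complex.ofReal_sub, Complex.norm_real,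
    Real.norm_of_nonneg (by linarith)]
  linarith

/-! ### Compatibility of all invariant states and the upper index. -/

theorem intervalIntegrable_inv_smul_of_monotoneOn {f : ℝ → ℝ} (hf : MonotoneOn f (Ioi 0))
    {u v : ℝ} (hu : 0 < u) (hv : 0 < v) :
    IntervalIntegrable (fun s => s⁻¹ • f s) volume u v := by
  have hsub : uIcc u v ⊆ Ioi 0 := fun s hs => (lt_min hu hv).trans_le hs.1
  exact (hf.mono hsub).intervalIntegrable.continuousOn_mul
    (continuousOn_id.inv₀ fun s hs => (hsub hs).ne')

/-- With G = log ψ, telescoping leaves the ds/s-integral of G over (Rt, aRt] minus that over (t,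
at]. Monotonicity bounds this below by log a · (G(Rt) − G(at)), and G(at) ≤ G(t) + log a. -/
theorem IsOmega.le_integral_logRatio {ψ : ℝ → ℝ} (hψ : IsOmega ψ) {a t R : ℝ} (ha : 1 < a)
    (ht : 0 < t) (hR : 1 < R) :
    (Real.log R)⁻¹ * (Real.log a * (logRatio ψ R t - Real.log a)) ≤
      ∫ s, logRatio ψ a s ∂logMeasure t R := by
  have ha0 : 0 < a := one_pos.trans ha
  have hRt : 0 < R * t := mul_pos (one_pos.trans hR) ht
  have hG := hψ.monotoneOn_log
  set G : ℝ → ℝ := fun s => Real.log (ψ s) with hGdef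
  have hGa : MonotoneOn (fun s => G (a * s)) (Ioi 0) := fun s hs u hu hsu =>
    hG (mul_pos ha0 hs) (mul_pos ha0 hu) (mul_le_mul_of_nonneg_left hsu ha0.le)
  have hint : ∀ u v : ℝ, 0 < u → 0 < v → IntervalIntegrable (fun s => s⁻¹ • G s) volume u v :=
    fun u v => intervalIntegrable_inv_smul_of_monotoneOn hG
  have hL := inv_pos.2 (Real.log_pos hR)
  have hconst : ∀ (u c : ℝ), 0 < u → ∫ s in u..a * u, s⁻¹ • c = Real.log a * c := by
    intro u c hu
    simp_rw [smul_eq_mul]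
    rw [intervalIntegral.integral_mul_const, integral_inv_of_pos hu (mul_pos ha0 hu),
      mul_div_cancel_right₀ _ hu.ne']
  have hconst_int : ∀ u c : ℝ, 0 < u →
      IntervalIntegrable (fun s : ℝ => s⁻¹ • c) volume u (a * u) := fun u c hu =>
    (intervalIntegrable_inv_pos hu (mul_pos ha0 hu)).mul_const c
  have h1 : Real.log a * G (R * t) ≤ ∫ s in R * t..a * (R * t), s⁻¹ • G s := by
    rw [← hconst _ _ hRt]
    refine intervalIntegral.integral_mono_on (lt_mul_of_one_lt_left hRt ha).le (hconst_int _ _ hRt)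
      (hint _ _ hRt (mul_pos ha0 hRt)) fun s hs => ?_
    have hs0 : 0 < s := hRt.trans_le hs.1
    exact smul_le_smul_of_nonneg_left (hG hRt hs0 hs.1) (inv_nonneg.2 hs0.le)
  have h2 : ∫ s in t..a * t, s⁻¹ • G s ≤ Real.log a * G (a * t) := by
    rw [← hconst _ _ ht]
    refine intervalIntegral.integral_mono_on (lt_mul_of_one_lt_left ht ha).le
      (hint _ _ ht (mul_pos ha0 ht)) (hconst_int _ _ ht) fun s hs => ?_
    have hs0 : 0 < s := ht.trans_le hs.1
    exact smul_le_smul_of_nonneg_left (hG hs0 (mul_pos ha0 ht) hs.2) (inv_nonneg.2 hs0.le)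
  have h3 : G (a * t) ≤ G t + Real.log a := by
    have := hψ.logRatio_le_log ha ht
    unfold logRatio at this
    simp only [hGdef]
    linarith
  rw [integral_logMeasure ht hR, smul_eq_mul]
  refine mul_le_mul_of_nonneg_left ?_ hL.le
  have h4 : ∫ s in t..R * t, s⁻¹ • logRatio ψ a s =
      (∫ s in t..R * t, s⁻¹ • G (a * s)) - ∫ s in t..R * t, s⁻¹ • G s := by
    rw [← intervalIntegral.integral_sub
      (intervalIntegrable_inv_smul_of_monotoneOn hGa ht hRt) (hint _ _ ht hRt)]
    simp_rw [← smul_sub]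
    rfl
  rw [h4, integral_inv_smul_dilate_sub ha0 ht hRt hint]
  have h5 : logRatio ψ R t = G (R * t) - G t := rfl
  have h6 := mul_le_mul_of_nonneg_left h3 (Real.log_pos ha).le
  rw [h5]
  linarith

/-- Otherwise there are arbitrarily large `R` and points `t` with ψ(Rt)/ψ(t) ≥ R^c. A limit of
logarithmic means over these intervals is at least c log a > 0 on the cocycle for every a > 1, so it
is not compatible. -/
theorem IsOmega.log_dilationSup_le_of_forall_compatible {ψ : ℝ → ℝ} (hψ : IsOmega ψ)
    (h : ∀ ω : LInftyHalfLine →L[ℂ] ℂ, IsState ω → IsDilationInvariant ω → IsCompatible hψ ω)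
    {c : ℝ} (hc : 0 < c) : ∀ᶠ a in atTop, Real.log (dilationSup ψ a) ≤ c * Real.log a := by
  by_contra hcon
  rw [not_eventually] at hcon
  have hex : ∀ n : ℕ, ∃ R t : ℝ, 1 < R ∧ (n : ℝ) ≤ R ∧ 0 < t ∧
      c * Real.log R ≤ logRatio ψ R t := by
    intro n
    obtain ⟨R, hR, hR1, hRn⟩ :=
      (hcon.and_eventually ((eventually_gt_atTop 1).and (eventually_ge_atTop (n : ℝ)))).exists
    have hR0 : 0 < R := one_pos.trans hR1
    rw [not_le, Real.lt_log_iff_exp_lt (hψ.dilationSup_pos hR0)] at hR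
    obtain ⟨_, ⟨t, ht, rfl⟩, ht2, -⟩ := (hψ.isLUB_dilationSup hR0).exists_between hR
    refine ⟨R, t, hR1, hRn, ht, ?_⟩
    rw [hψ.logRatio_eq hR0 ht,
      Real.le_log_iff_exp_le (div_pos (hψ.pos (mul_pos hR0 ht)) (hψ.pos ht))]
    exact ht2.le
  choose R t hR hRn ht htψ using hex
  have hRt : Tendsto R atTop atTop := tendsto_atTop_mono hRn tendsto_natCast_atTop_atTop
  obtain ⟨ω, hω, hinv, hlim⟩ := exists_tendsto_logMean ht hR hRt
  obtain ⟨a, ha, hωa⟩ := h ω hω hinv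
  rw [hψ.map_ratio_eq_one_iff hω ha] at hωa
  have hla := Real.log_pos ha
  have h1 := (Complex.continuous_re.tendsto _).comp (hlim (hψ.memLp_logRatio ha).toLp)
  rw [hωa, Complex.zero_re] at h1
  have h2 : Tendsto (fun n => Real.log a * (c - (Real.log (R n))⁻¹ * Real.log a))
      (hyperfilter ℕ : Filter ℕ) (𝓝 (Real.log a * (c - 0 * Real.log a))) :=
    (tendsto_const_nhds.mul (tendsto_const_nhds.sub ((tendsto_inv_atTop_zero.comp
      (Real.tendsto_log_atTop.comp hRt)).mul_const _))).mono_left Nat.hyperfilter_le_atTop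
  have h3 := le_of_tendsto_of_tendsto' h2 h1 fun n => by
    rw [Function.comp_apply, logMean_toLp, integral_complex_ofReal, Complex.ofReal_re]
    refine le_trans ?_ (hψ.le_integral_logRatio ha (ht n) (hR n))
    have hL := Real.log_pos (hR n)
    calc Real.log a * (c - (Real.log (R n))⁻¹ * Real.log a)
        = (Real.log (R n))⁻¹ * (Real.log a * (c * Real.log (R n) - Real.log a)) := by
          field_simp
      _ ≤ _ := by
          have := htψ n
          gcongr
  rw [zero_mul, sub_zero] at h3
  linarith [mul_pos hla hc]

theorem IsOmega.compatible_of_log_dilationSup_le {ψ : ℝ → ℝ} (hψ : IsOmega ψ)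
    (h : ∀ c, 0 < c → ∀ᶠ a in atTop, Real.log (dilationSup ψ a) ≤ c * Real.log a)
    {ω : LInftyHalfLine →L[ℂ] ℂ} (hω : IsState ω) (hinv : IsDilationInvariant ω) :
    IsCompatible hψ ω := by
  have h2 : (1 : ℝ) < 2 := one_lt_two
  refine ⟨2, h2, (hψ.map_ratio_eq_one_iff hω h2).2 ?_⟩
  have h0 := hψ.map_logRatio_nonneg hω h2
  have hle : (ω (hψ.memLp_logRatio h2).toLp).re ≤ 0 := by
    refine le_of_forall_pos_le_add fun ε hε => ?_
    have hl2 := Real.log_pos h2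
    -- The slope ε / log 2 makes the bound at 2^(n+1) equal to (n + 1)ε; additivity then cancels the
    -- factor n + 1.
    obtain ⟨n, hn⟩ := (((tendsto_pow_atTop_atTop_of_one_lt h2).comp
      (tendsto_add_atTop_nat 1)).eventually (h (ε / Real.log 2) (div_pos hε hl2))).exists
    have hn1 : (1 : ℝ) < 2 ^ (n + 1) := one_lt_pow₀ h2 n.succ_ne_zero
    rw [Function.comp_apply, Real.log_pow, mul_left_comm, div_mul_cancel₀ _ hl2.ne'] at hn
    have h1 := hω.mono (hψ.memLp_logRatio hn1) (memLp_ofReal_const (((n + 1 : ℕ) : ℝ) * ε))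
      fun t ht => by
        have hp := one_pos.trans hn1
        rw [hψ.logRatio_eq hp ht]
        exact (Real.log_le_log (div_pos (hψ.pos (mul_pos hp ht)) (hψ.pos ht))
          (hψ.ratio_le_dilationSup hp ht)).trans hn
    rw [hψ.map_logRatio_pow hinv h2 n hn1, hω.map_const] at h1
    have h3 := (Complex.le_def.1 h1).1
    rw [Complex.ofReal_re, ← Complex.ofReal_natCast, Complex.re_ofReal_mul] at h3
    rw [zero_add]
    exact le_of_mul_le_mul_left h3 (by positivity)
  -- The order on ℂ forces equal imaginary parts, so nonnegativity also shows that the value is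
  -- real.
  obtain ⟨hre, him⟩ := Complex.le_def.1 h0
  exact Complex.ext (le_antisymm hle hre) him.symm

/-- Ensures that compatibility of all invariant states is not vacuous, so that it yields a
compatible state and hence the lower index. -/
theorem exists_dilationInvariant_state :
    ∃ ω : LInftyHalfLine →L[ℂ] ℂ, IsState ω ∧ IsDilationInvariant ω := by
  obtain ⟨ω, hω, hinv, -⟩ := exists_tendsto_logMean (t := fun _ => 1) (R := fun n => (n : ℝ) + 2)
    (fun _ => one_pos) (fun n => by linarith [n.cast_nonneg (α := ℝ)])
    (tendsto_atTop_add_const_right _ _ tendsto_natCast_atTop_atTop)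
  exact ⟨ω, hω, hinv⟩

theorem mainTheorem11 (ψ : ℝ → ℝ) (hψ : IsOmega ψ) :
    ((∃ ω : LInftyHalfLine →L[ℂ] ℂ, IsState ω ∧ IsDilationInvariant ω ∧ IsCompatible hψ ω) ↔
      HasLowerBoydIndex (lorentzNorm ψ) 1) ∧
    ((∀ ω : LInftyHalfLine →L[ℂ] ℂ, IsState ω → IsDilationInvariant ω → IsCompatible hψ ω) ↔
      HasLowerBoydIndex (lorentzNorm ψ) 1 ∧ HasUpperBoydIndex (lorentzNorm ψ) 1) := by
  have hlower : (∃ ω : LInftyHalfLine →L[ℂ] ℂ,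
      IsState ω ∧ IsDilationInvariant ω ∧ IsCompatible hψ ω) ↔
        HasLowerBoydIndex (lorentzNorm ψ) 1 := by
    rw [hψ.hasLowerBoydIndex_one_iff]
    exact ⟨fun ⟨_, hω, hinv, hc⟩ _ hb hb1 =>
      hψ.dilationSup_eq_one_of_compatible hω hinv hc hb hb1, hψ.exists_compatible⟩
  refine ⟨hlower, fun h => ⟨hlower.1 ?_, hψ.hasUpperBoydIndex_one_iff.2 fun _ hc =>
    hψ.log_dilationSup_le_of_forall_compatible h hc⟩, fun h _ hω hinv =>
    hψ.compatible_of_log_dilationSup_le (hψ.hasUpperBoydIndex_one_iff.1 h.2) hω hinv⟩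
  obtain ⟨ω, hω, hinv⟩ := exists_dilationInvariant_state
  exact ⟨ω, hω, hinv, h ω hω hinv⟩
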